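/- Let $G$ be a finite connected graph, in which loops and parallel edges are allowed. An edge is \emph{external} if one of its ends has valency $1$ (a loop contributes $2$ to the valency of its vertex); all other edges are \emph{internal}. Let $N$ be the number of external edges and $n$ the number of internal edges, and let $x=(x_e)$ be variables indexed by the internal edges. A \emph{kinematic parameter} is a pair $z=(K,m)$, where $K=(k_{ij})$ is a real symmetric $N\times N$ matrix with zero row sums, indexed by the external edges, and $m=(m_e)$ is a real vector indexed by the internal edges. With the coordinates $k_{ij}$ for pairs $\{i,j\}$ with $i\ne j$, and $m_e$, we identify the space of kinematic parameters with $\mathbb{R}^{\binom N2+n}$. Let $\mathcal{T}$ be the set of spanning trees of $G$, and let $\mathcal{W}$ be the set of spanning $2$-forests of $G$, i.e. of subgraphs without cycles that contain all vertices and all external edges and have exactly two connected components $T_1,T_2$. Let $I_{T_1}$ and $I_{T_2}$ be the sets of external edges attached to $T_1$ and $T_2$. Put $$\mathcal{U}(x)=\sum_{T\in\mathcal{T}}\ \prod_{e\notin T}x_e,\qquad \mathcal{F}_z(x)=\sum_{\{T_1,T_2\}\in\mathcal{W}}\Bigl(\sum_{i\in I_{T_1}}\sum_{j\in I_{T_2}}k_{ij}\Bigr)\prod_{e\notin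 T_1\sqcup T_2}x_e+\Bigl(\sum_{e}m_ex_e\Bigr)\,\mathcal{U}(x).$$ The \emph{copositive cone} of $G$ is $$\mathcal{C}_G=\bigl\{z\in\mathbb{R}^{\binom N2+n}:\ \mathcal{F}_z(u)\ge 0\ \text{ for all } u\in\mathbb{R}^n_{\ge 0}\bigr\}.$$ \textbf{Proposition.} The set $\mathcal{C}_G$ is a full-dimensional closed semialgebraic convex cone in $\mathbb{R}^{\binom N2+n}$. More precisely: (a) for every $u\in\mathbb{R}^n$ the function $z\mapsto\mathcal{F}_z(u)$ is linear, so that $\mathcal{C}_G$ is the solution set of the linear inequalities $\mathcal{F}_z(u)\ge 0$, one for each $u\in\mathbb{R}^n_{\ge0}$; (b) $\mathcal{C}_G$ is closed and convex, contains $0$, and is closed under multiplication by nonnegative real numbers; (c) $\mathcal{C}_G$ contains the open orthant $\mathbb{R}^{\binom N2+n}_{>0}$ in the coordinates $k_{ij}$ $(i\neq j)$ and $m_e$, and it has nonempty interior; (d) $\mathcal{C}_G$ is semialgebraic, i.e. a finite Boolean combination of sets of the form $\{z: p(z)\ge 0\}$ with $p$ a real polynomial in $z$. -/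

import Mathlib

namespace Feynman

open MvPolynomial

noncomputable section

/-! ### Graphs

`Graph α β` is Mathlib's type of multigraphs: loops and parallel edges are allowed. -/

/-- The valency of a vertex: the number of incident edges, where a loop counts twice. -/
def valency {α β : Type*} (G : Graph α β) (v : α) : ℕ :=
  (G.incidenceSet v).ncard + (G.loopSet v).ncard

/-- An edge is external if one of its ends is a vertex of valency `1`. -/
def IsExternal {α β : Type*} (G : Graph α β) (e : β) : Prop :=
  ∃ v, valency G v = 1 ∧ G.Inc e v

/-- The type of external edges of `G`. -/
abbrev External {α β : Type*} (G : Graph α β) : Type _ :=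
  {e : β // e ∈ G.edgeSet ∧ IsExternal G e}

/-- The type of internal edges of `G`. -/
abbrev Internal {α β : Type*} (G : Graph α β) : Type _ :=
  {e : β // e ∈ G.edgeSet ∧ ¬ IsExternal G e}

/-- A multigraph is connected: it has a vertex, and any two vertices are joined by a walk. -/
def IsConnected {α β : Type*} (G : Graph α β) : Prop :=
  G.toSimpleGraph.Connected

/-- A multigraph has no cycles: it has no loops and no parallel edges (these are the cycles
of length `1` and `2`), and its underlying simple graph has no cycles. -/
def IsForest {α β : Type*} (G : Graph α β) : Prop :=
  G.Simple ∧ G.toSimpleGraph.IsAcyclic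

/-- The set `T` of edges of `G` is the edge set of a spanning tree of `G`.
Here `G.restrict T` is the subgraph with all the vertices of `G` and with edge set `T`. -/
def IsSpanningTree {α β : Type*} (G : Graph α β) (T : Finset β) : Prop :=
  (T : Set β) ⊆ G.edgeSet ∧ IsForest (G.restrict T) ∧ IsConnected (G.restrict T)

/-- The connected components of the spanning subgraph of `G` with edge set `S`. -/
abbrev Component {α β : Type*} (G : Graph α β) (S : Finset β) : Type _ :=
  (G.restrict S).toSimpleGraph.ConnectedComponent

/-- The set `S` of edges of `G` is the edge set of a spanning `2`-forest of `G`: it contains all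
external edges, it has no cycles, and it has exactly two connected components. -/
def IsSpanningTwoForest {α β : Type*} (G : Graph α β) (S : Finset β) : Prop :=
  (S : Set β) ⊆ G.edgeSet ∧ (∀ e ∈ G.edgeSet, IsExternal G e → e ∈ S) ∧
    IsForest (G.restrict S) ∧ Nat.card (Component G S) = 2

/-- The external edge `i` is attached to the connected component `T` of the spanning subgraph
with edge set `S`. -/
def IsAttached {α β : Type*} {G : Graph α β} {S : Finset β} (i : External G)
    (T : Component G S) : Prop :=
  ∃ v : (G.restrict S).vertexSet,
    (G.restrict S).toSimpleGraph.connectedComponentMk v = T ∧ (G.restrict S).Inc i.1 v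

/-! ### Kinematic parameters -/

/-- The coordinates of the kinematic space: one for each unordered pair `{i, j}` of distinct
external edges, for the parameter `k_ij`, and one for each internal edge `e`, for the
mass `m_e`. -/
abbrev KinIndex {α β : Type*} (G : Graph α β) : Type _ :=
  {p : Sym2 (External G) // ¬ p.IsDiag} ⊕ Internal G

/-- The kinematic space `ℝ^(binom(N, 2) + n)`. -/
abbrev KinSpace {α β : Type*} (G : Graph α β) : Type _ := KinIndex G → ℝ

/-- The internal masses. -/
def mass {α β : Type*} {G : Graph α β} (z : KinSpace G) (e : Internal G) : ℝ := z (Sum.inr e)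

open Classical in
/-- The off-diagonal part of the Gram matrix. -/
def offDiagGram {α β : Type*} {G : Graph α β} (z : KinSpace G) (i j : External G) : ℝ :=
  if h : i = j then 0 else z (Sum.inl ⟨s(i, j), fun hd => h (Sym2.mk_isDiag_iff.1 hd)⟩)

open Classical in
/-- The Gram matrix `K = (k_ij)`. Its off-diagonal entries are coordinates of `z`, and its diagonal
entries are such that all row sums are zero (momentum conservation). -/
def gram {α β : Type*} [Fintype β] {G : Graph α β} (z : KinSpace G) (i j : External G) : ℝ :=
  if i = j then -∑ l, offDiagGram z i l else offDiagGram z i j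

theorem offDiagGram_comm {α β : Type*} {G : Graph α β} (z : KinSpace G)
    (i j : External G) : offDiagGram z i j = offDiagGram z j i := by
  unfold offDiagGram
  by_cases h : i = j
  · subst h; rfl
  · rw [dif_neg h, dif_neg (Ne.symm h)]
    congr 2
    exact Subtype.ext Sym2.eq_swap

theorem gram_comm {α β : Type*} [Fintype β] {G : Graph α β} (z : KinSpace G)
    (i j : External G) : gram z i j = gram z j i := by
  unfold gram
  by_cases h : i = j
  · subst h; rfl
  · rw [if_neg h, if_neg (Ne.symm h), offDiagGram_comm z i j]

open Classical in
/-- The kinematic space parametrizes the pairs `(K, m)` where `K` is a symmetric matrix with zero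
row sums and `m` is an arbitrary vector of masses, each pair exactly once. -/
theorem existsUnique_kinematics {α β : Type*} [Fintype β] (G : Graph α β)
    (K : External G → External G → ℝ) (m : Internal G → ℝ) :
    ((∀ i j, K i j = K j i) ∧ ∀ i, ∑ j, K i j = 0) ↔ ∃! z : KinSpace G, gram z = K ∧ mass z = m := by
  have hoff : ∀ (z : KinSpace G) (i j : External G) (h : i ≠ j),
      gram z i j = z (Sum.inl ⟨s(i, j), fun hd => h (Sym2.mk_isDiag_iff.1 hd)⟩) := by
    intro z i j h
    simp [gram, offDiagGram, h]
  have hrow : ∀ (z : KinSpace G) (i : External G), ∑ j, gram z i j = 0 := by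
    intro z i
    have h1 : ∑ j ∈ Finset.univ.erase i, gram z i j
        = ∑ j ∈ Finset.univ.erase i, offDiagGram z i j :=
      Finset.sum_congr rfl fun j hj => if_neg (Finset.ne_of_mem_erase hj).symm
    have h2 : offDiagGram z i i = 0 := dif_pos rfl
    have h3 : gram z i i = -∑ l, offDiagGram z i l := if_pos rfl
    rw [← Finset.add_sum_erase _ _ (Finset.mem_univ i), h1, h3,
      ← Finset.add_sum_erase _ (offDiagGram z i) (Finset.mem_univ i), h2]
    ring
  constructor
  · rintro ⟨hs', hr⟩
    refine ⟨Sum.elim (fun p => Sym2.lift ⟨fun i j => K i j, hs'⟩ p.1) m, ⟨?_, ?_⟩, ?_⟩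
    · set z : KinSpace G := Sum.elim (fun p => Sym2.lift ⟨fun i j => K i j, hs'⟩ p.1) m with hz
      have hne : ∀ i j, i ≠ j → gram z i j = K i j := by
        intro i j h
        rw [hoff z i j h]
        simp [hz]
      funext i j
      by_cases h : i = j
      · subst h
        have h1 := hrow z i
        have h2 := hr i
        rw [← Finset.add_sum_erase _ _ (Finset.mem_univ i)] at h1 h2
        have h3 : ∑ x ∈ Finset.univ.erase i, gram z i x
            = ∑ x ∈ Finset.univ.erase i, K i x :=
          Finset.sum_congr rfl fun x hx => hne i x (Finset.ne_of_mem_erase hx).symm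
        linarith
      · exact hne i j h
    · rfl
    · rintro w ⟨hw, hm⟩
      funext q
      rcases q with ⟨p, hp⟩ | e
      · induction p with
        | h i j =>
          have hij : i ≠ j := fun h => hp (Sym2.mk_isDiag_iff.2 h)
          rw [← hoff w i j hij, hw]
          simp
      · rw [← hm]; rfl
  · rintro ⟨z, ⟨hz, -⟩, -⟩
    subst hz
    exact ⟨gram_comm z, hrow z⟩

/-! ### Symanzik polynomials -/

open Classical in
/-- The product of the variables `x_e` over the internal edges `e` outside `S`. -/
def complMonomial {α β : Type*} [Fintype β] (G : Graph α β) (S : Finset β) :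
    MvPolynomial (Internal G) ℝ :=
  ∏ e : Internal G with e.1 ∉ S, X e

open Classical in
/-- The first Symanzik polynomial `𝒰`. For connected `G`, the edges outside a spanning tree are all
internal. -/
def firstSymanzik {α β : Type*} [Fintype β] (G : Graph α β) :
    MvPolynomial (Internal G) ℝ :=
  ∑ T : Finset β with IsSpanningTree G T, complMonomial G T

open Classical in
/-- The sum of `k_ij` over the external edges `i` attached to `T₁` and `j` attached to `T₂`. -/
def crossSum {α β : Type*} [Fintype β] {G : Graph α β} (z : KinSpace G) {S : Finset β}
    (T₁ T₂ : Component G S) : ℝ :=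
  ∑ i : External G with IsAttached i T₁, ∑ j : External G with IsAttached j T₂, gram z i j

theorem crossSum_comm {α β : Type*} [Fintype β] {G : Graph α β} (z : KinSpace G)
    {S : Finset β} (T₁ T₂ : Component G S) : crossSum z T₁ T₂ = crossSum z T₂ T₁ := by
  unfold crossSum
  rw [Finset.sum_comm]
  exact Finset.sum_congr rfl fun j _ => Finset.sum_congr rfl fun i _ => gram_comm z i j

/-- The coefficient of a spanning `2`-forest: `crossSum z T₁ T₂` for the unordered pair `{T₁, T₂}`
of its two components. (For a spanning `2`-forest the sum has a single term.) -/
def forestCoeff {α β : Type*} [Fintype β] {G : Graph α β} (z : KinSpace G)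
    (S : Finset β) : ℝ :=
  ∑ᶠ q : {q : Sym2 (Component G S) // ¬ q.IsDiag},
    Sym2.lift ⟨fun T₁ T₂ => crossSum z T₁ T₂, crossSum_comm z⟩ q.1

open Classical in
/-- The second Symanzik polynomial `ℱ_z`. -/
def secondSymanzik {α β : Type*} [Fintype β] (G : Graph α β) (z : KinSpace G) :
    MvPolynomial (Internal G) ℝ :=
  (∑ S : Finset β with IsSpanningTwoForest G S, C (forestCoeff z S) * complMonomial G S) +
    (∑ e : Internal G, C (mass z e) * X e) * firstSymanzik G

/-! ### Copositivity and semialgebraic sets -/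

/-- A polynomial is copositive if it is nonnegative on the nonnegative orthant. -/
def IsCopositive {σ : Type*} (f : MvPolynomial σ ℝ) : Prop :=
  ∀ x : σ → ℝ, (∀ i, 0 ≤ x i) → 0 ≤ eval x f

/-- The copositive cone `𝒞_G`. -/
def copositiveCone {α β : Type*} [Fintype β] (G : Graph α β) : Set (KinSpace G) :=
  {z | IsCopositive (secondSymanzik G z)}

/-- Semialgebraic subsets of `ℝ^σ`: the finite Boolean combinations of sets that are defined by one
polynomial inequality. -/
inductive IsSemialgebraic {σ : Type*} : Set (σ → ℝ) → Prop
  | nonneg (p : MvPolynomial σ ℝ) : IsSemialgebraic {z | 0 ≤ eval z p}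
  | compl (A : Set (σ → ℝ)) : IsSemialgebraic A → IsSemialgebraic Aᶜ
  | inter (A B : Set (σ → ℝ)) : IsSemialgebraic A → IsSemialgebraic B → IsSemialgebraic (A ∩ B)

end

end Feynman

/-!
For fixed `u ≥ 0` the value `ℱ_z(u)` is linear in `z`, so the copositive cone is an intersection of
closed half-spaces. An external edge is attached to only one component of a spanning `2`-forest,
hence only off-diagonal entries of the Gram matrix enter `ℱ_z`, and on the positive orthant all its
coefficients are nonnegative.

The complement of the cone is the projection of a semialgebraic set in the variables `(z, u)`, so
the cone is semialgebraic by the Tarski–Seidenberg theorem. To eliminate one variable from a finite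
family of polynomials, close the family under derivatives, truncation of leading terms and
pseudo-remainders. Two specializations of the coefficients for which the leading coefficients have
the same signs then decompose the line into sign cells of the same kinds in the same order. The
polynomials are treated by increasing degree. The sign of the next polynomial at a root of an
earlier one is read off a pseudo-remainder; on an open cell it is monotone, so that its signs there
are determined by the ends of the cell. The lemma of Thom, that the signs of a polynomial and its
derivatives determine the order of the cells, shows that the new cells come in the same order.
-/

namespace Feynman

open Polynomial Filter
open SignType (sign)

/-! ### The lemma of Thom -/

theorem sign_eval_sub_eval_eq {p : ℝ[X]} {x y : ℝ} {s : SignType} (hxy : x < y)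
    (hs : ∀ t ∈ Set.Ioo x y, sign (p.derivative.eval t) = s) :
    sign (p.eval y - p.eval x) = s := by
  obtain ⟨t, ht, hslope⟩ := exists_hasDerivAt_eq_slope (fun t => p.eval t) _ hxy
    p.continuous.continuousOn fun t _ => p.hasDerivAt t
  have hpos : 0 < y - x := sub_pos.2 hxy
  rw [eq_div_iff hpos.ne'] at hslope
  rw [← hslope, sign_mul, sign_pos hpos, mul_one, hs t ht]

theorem sign_eq_sign_of_sign_sub_eq {R : Type*} [Ring R] [LinearOrder R] [IsOrderedRing R]
    {a b a' b' : R} (ha : sign a = sign a') (hb : sign b = sign b')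
    (h : sign (b - a) = sign (a' - b')) : sign a = sign b := by
  rcases le_total a b with hab | hba
  · have hba' : b' ≤ a' := by
      rwa [← sub_nonneg, ← sign_nonneg_iff, ← h, sign_nonneg_iff, sub_nonneg]
    exact le_antisymm (sign.monotone hab) (hb ▸ ha ▸ sign.monotone hba')
  · have hab' : a' ≤ b' := by
      rwa [← sub_nonpos, ← sign_nonpos_iff, ← h, sign_nonpos_iff, sub_nonpos]
    exact le_antisymm (ha ▸ hb ▸ sign.monotone hab') (sign.monotone hba)

theorem sign_eval_eq_of_mem_Icc (p : ℝ[X]) {x y : ℝ}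
    (hxy : ∀ k, sign ((derivative^[k] p).eval x) = sign ((derivative^[k] p).eval y))
    {t : ℝ} (ht : t ∈ Set.Icc x y) : sign (p.eval t) = sign (p.eval x) := by
  induction hn : p.natDegree using Nat.strong_induction_on generalizing p t with
  | _ n ih =>
  rcases eq_or_ne n 0 with rfl | hn0
  · rw [eq_C_of_natDegree_eq_zero hn, eval_C, eval_C]
  rcases ht.1.eq_or_lt with rfl | hxt
  · rfl
  rcases ht.2.eq_or_lt with rfl | hty
  · exact (hxy 0).symm
  have hder : ∀ r ∈ Set.Icc x y,
      sign (p.derivative.eval r) = sign (p.derivative.eval x) := fun r hr =>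
    ih _ (hn ▸ natDegree_derivative_lt (hn ▸ hn0)) _ (fun k => hxy (k + 1)) hr rfl
  have hleft : sign (p.eval t - p.eval x) = sign (p.derivative.eval x) :=
    sign_eval_sub_eval_eq hxt fun r hr => hder r ⟨hr.1.le, hr.2.le.trans hty.le⟩
  have hright : sign (p.eval y - p.eval t) = sign (p.derivative.eval x) :=
    sign_eval_sub_eval_eq hty fun r hr => hder r ⟨hxt.le.trans hr.1.le, hr.2.le⟩
  exact (sign_eq_sign_of_sign_sub_eq (hxy 0) rfl (hleft.trans hright.symm)).symm

theorem lt_of_sign_derivatives_eq (p q : ℝ[X]) {x₁ x₂ y₁ y₂ : ℝ}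
    (h₁ : ∀ k, sign ((derivative^[k] p).eval x₁) = sign ((derivative^[k] q).eval y₁))
    (h₂ : ∀ k, sign ((derivative^[k] p).eval x₂) = sign ((derivative^[k] q).eval y₂))
    (hne : ∃ k, sign ((derivative^[k] p).eval x₁) ≠ sign ((derivative^[k] p).eval x₂))
    (hx : x₁ < x₂) : y₁ < y₂ := by
  induction hn : p.natDegree using Nat.strong_induction_on generalizing p q with
  | _ n ih =>
  by_cases hder : ∃ k, sign ((derivative^[k] (derivative p)).eval x₁) ≠
      sign ((derivative^[k] (derivative p)).eval x₂)
  · have hn0 : p.natDegree ≠ 0 := fun h0 => by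
      simp [derivative_of_natDegree_zero h0] at hder
    exact ih _ (hn ▸ natDegree_derivative_lt hn0) _ (derivative q) (fun k => h₁ (k + 1))
      (fun k => h₂ (k + 1)) hder rfl
  push Not at hder
  have hne₀ : sign (p.eval x₁) ≠ sign (p.eval x₂) := by
    obtain ⟨_ | k, hk⟩ := hne
    · exact hk
    · exact absurd (hder k) hk
  by_contra! hy
  have hy : y₂ < y₁ := hy.lt_of_ne fun h => hne₀ ((h₁ 0).trans (h ▸ (h₂ 0).symm))
  have hdery : ∀ k, sign ((derivative^[k] (derivative q)).eval y₂) =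
      sign ((derivative^[k] (derivative q)).eval y₁) := fun k =>
    (h₂ (k + 1)).symm.trans ((hder k).symm.trans (h₁ (k + 1)))
  have hp : sign (p.eval x₂ - p.eval x₁) = sign (p.derivative.eval x₁) :=
    sign_eval_sub_eval_eq hx fun t ht =>
      sign_eval_eq_of_mem_Icc _ hder (Set.Ioo_subset_Icc_self ht)
  have hq : sign (q.eval y₁ - q.eval y₂) = sign (p.derivative.eval x₁) :=
    sign_eval_sub_eval_eq hy fun t ht =>
      (sign_eval_eq_of_mem_Icc _ hdery (Set.Ioo_subset_Icc_self ht)).trans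
        ((hdery 0).trans (h₁ 1).symm)
  exact hne₀ (sign_eq_sign_of_sign_sub_eq (h₁ 0) (h₂ 0) (hp.trans hq.symm))

/-! ### Cell matchings of the real line -/

/-- The fibres of `a` and those of `b` partition the line into cells. The two partitions are
matched if the same values occur and the cells of distinct values come in the same order, where
points `x` and `y` are matched when `a x = b y`. -/
structure IsCellMatching {V : Type*} (a b : ℝ → V) : Prop where
  range_eq : Set.range a = Set.range b
  lt_of_lt : ∀ ⦃x₁ x₂ y₁ y₂ : ℝ⦄, a x₁ = b y₁ → a x₂ = b y₂ → a x₁ ≠ a x₂ → x₁ < x₂ → y₁ < y₂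

namespace IsCellMatching

variable {V : Type*} {a b : ℝ → V}

theorem symm (h : IsCellMatching a b) : IsCellMatching b a where
  range_eq := h.range_eq.symm
  lt_of_lt y₁ y₂ x₁ x₂ h₁ h₂ hne hy := by
    rw [h₁, h₂] at hne
    refine (lt_trichotomy x₁ x₂).resolve_right ?_
    rintro (rfl | hx)
    · exact hne rfl
    · exact hy.asymm (h.lt_of_lt h₂.symm h₁.symm hne.symm hx)

theorem comp_neg (h : IsCellMatching a b) : IsCellMatching (a ∘ Neg.neg) (b ∘ Neg.neg) where
  range_eq := by
    rw [neg_surjective.range_comp, neg_surjective.range_comp, h.range_eq]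
  lt_of_lt _ _ _ _ h₁ h₂ hne hx :=
    neg_lt_neg_iff.1 (h.lt_of_lt h₂ h₁ hne.symm (neg_lt_neg hx))

theorem exists_eq (h : IsCellMatching a b) (x : ℝ) : ∃ y, b y = a x :=
  h.range_eq.subset (Set.mem_range_self x)

theorem ordConnected (h : IsCellMatching a b) (v : V) : (a ⁻¹' {v}).OrdConnected := by
  refine ⟨fun x₁ hx₁ x₂ hx₂ t ht => ?_⟩
  rw [Set.mem_preimage, Set.mem_singleton_iff] at hx₁ hx₂ ⊢
  by_contra hne
  obtain ⟨y, hy⟩ := h.exists_eq x₁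
  obtain ⟨s, hs⟩ := h.exists_eq t
  have hx₁t : x₁ < t := ht.1.lt_of_ne fun hxt => hne (hxt ▸ hx₁)
  have htx₂ : t < x₂ := ht.2.lt_of_ne fun htx => hne (htx ▸ hx₂)
  have hys : y < s := h.lt_of_lt hy.symm hs.symm (hx₁ ▸ Ne.symm hne) hx₁t
  have hsy : s < y := h.lt_of_lt hs.symm (hx₂.trans (hx₁ ▸ hy.symm)) (hx₂ ▸ hne) htx₂
  exact hys.asymm hsy

theorem mem_upperBounds (h : IsCellMatching a b) {v : V} {c e : ℝ} (hce : a c = b e)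
    (hcv : a c ≠ v) (hc : c ∈ upperBounds (a ⁻¹' {v})) : e ∈ upperBounds (b ⁻¹' {v}) := by
  rintro s rfl
  obtain ⟨x, hx⟩ := h.symm.exists_eq s
  have hxc : x < c := (hc hx).lt_of_ne fun hxc => hcv (hxc ▸ hx)
  exact (h.lt_of_lt hx hce (hx ▸ hcv.symm) hxc).le

end IsCellMatching

theorem notMem_of_mem_upperBounds_of_isOpen {U : Set ℝ} (hU : IsOpen U) {c : ℝ}
    (hc : c ∈ upperBounds U) : c ∉ U := fun hcU => by
  obtain ⟨t, hct, htU⟩ := ((frequently_gt_nhds c).and_eventually (hU.mem_nhds hcU)).exists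
  exact hct.not_ge (hc htU)

theorem IsCellMatching.eq_of_isLUB {V : Type*} {a b : ℝ → V} (h : IsCellMatching a b) {v : V}
    (ha : IsOpen (a ⁻¹' {v})) (hb : IsOpen (b ⁻¹' {v})) {c d : ℝ}
    (hc : IsLUB (a ⁻¹' {v}) c) (hd : IsLUB (b ⁻¹' {v}) d) : a c = b d := by
  have hcv : a c ≠ v := notMem_of_mem_upperBounds_of_isOpen ha hc.1
  have hdv : b d ≠ v := notMem_of_mem_upperBounds_of_isOpen hb hd.1
  obtain ⟨e, he⟩ := h.exists_eq c
  obtain ⟨f, hf⟩ := h.symm.exists_eq d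
  have hde : d ≤ e := hd.2 (h.mem_upperBounds he.symm hcv hc.1)
  have hcf : c ≤ f := hc.2 (h.symm.mem_upperBounds hf.symm hdv hd.1)
  by_contra hne
  have hde : d < e := hde.lt_of_ne fun hde => hne (hde ▸ he.symm)
  exact hcf.not_gt (h.symm.lt_of_lt hf.symm he (he ▸ Ne.symm hne) hde)

theorem IsCellMatching.exists_isLUB {V : Type*} {a b : ℝ → V} (h : IsCellMatching a b) {v : V}
    (ha : IsOpen (a ⁻¹' {v})) (hb : IsOpen (b ⁻¹' {v})) (hne : (b ⁻¹' {v}).Nonempty)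
    (hbdd : BddAbove (b ⁻¹' {v})) :
    ∃ c d, IsLUB (a ⁻¹' {v}) c ∧ IsLUB (b ⁻¹' {v}) d ∧ a c = b d := by
  obtain ⟨d, hd⟩ := Real.exists_isLUB hne hbdd
  obtain ⟨e, he⟩ := h.symm.exists_eq d
  have hdv : b d ≠ v := notMem_of_mem_upperBounds_of_isOpen hb hd.1
  have hbdd' : BddAbove (a ⁻¹' {v}) := ⟨e, h.symm.mem_upperBounds he.symm hdv hd.1⟩
  have hne' : (a ⁻¹' {v}).Nonempty := by
    obtain ⟨y, rfl⟩ := hne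
    exact h.symm.exists_eq y
  obtain ⟨c, hc⟩ := Real.exists_isLUB hne' hbdd'
  exact ⟨c, d, hc, hd, h.eq_of_isLUB ha hb hc hd⟩

/-- The polynomials `p` and `q` are matched to first order: their derivatives have the same signs
at matched points, and so have `p` and `q` themselves except possibly on open cells. -/
structure IsAlmostMatched {V : Type*} (a b : ℝ → V) (p q : ℝ[X]) : Prop
    extends IsCellMatching a b where
  sign_derivative_eq : ∀ ⦃x y⦄, a x = b y →
    sign (p.derivative.eval x) = sign (q.derivative.eval y)
  sign_eq_or_isOpen : ∀ ⦃x y⦄, a x = b y → sign (p.eval x) = sign (q.eval y) ∨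
    IsOpen (a ⁻¹' {a x}) ∧ IsOpen (b ⁻¹' {a x})

theorem exists_eval_pos_of_derivative_pos_Ici {q : ℝ[X]} {y : ℝ}
    (hq : ∀ t ∈ Set.Ici y, 0 < q.derivative.eval t) : ∃ t ∈ Set.Ici y, 0 < q.eval t := by
  have hdeg : 0 < q.degree := by
    rw [← natDegree_pos_iff_degree_pos, Nat.pos_iff_ne_zero]
    intro h0
    simpa [derivative_of_natDegree_zero h0] using hq y Set.self_mem_Ici
  obtain ⟨t, hty, htq⟩ := ((eventually_gt_atTop y).and
    ((q.abs_tendsto_atTop hdeg).eventually_gt_atTop |q.eval y|)).exists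
  have hincr : sign (q.eval t - q.eval y) = 1 :=
    sign_eval_sub_eval_eq hty fun r hr => sign_pos (hq r hr.1.le)
  rw [sign_eq_one_iff, sub_pos] at hincr
  refine ⟨t, hty.le, lt_of_not_ge fun ht => htq.not_gt ?_⟩
  rwa [abs_of_nonpos ht, abs_of_neg (hincr.trans_le ht), neg_lt_neg_iff]

namespace IsAlmostMatched

variable {V : Type*} {a b : ℝ → V} {p q : ℝ[X]}

theorem symm (h : IsAlmostMatched a b p q) : IsAlmostMatched b a q p where
  toIsCellMatching := h.toIsCellMatching.symm
  sign_derivative_eq _ _ hyx := (h.sign_derivative_eq hyx.symm).symm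
  sign_eq_or_isOpen _ _ hyx := by
    rw [hyx]
    exact (h.sign_eq_or_isOpen hyx.symm).imp Eq.symm And.symm

theorem neg (h : IsAlmostMatched a b p q) : IsAlmostMatched a b (-p) (-q) where
  toIsCellMatching := h.toIsCellMatching
  sign_derivative_eq _ _ hxy := by
    simp only [derivative_neg, eval_neg, Left.sign_neg, h.sign_derivative_eq hxy]
  sign_eq_or_isOpen _ _ hxy := by
    simpa only [eval_neg, Left.sign_neg, neg_inj] using h.sign_eq_or_isOpen hxy

theorem comp_neg (h : IsAlmostMatched a b p q) :
    IsAlmostMatched (a ∘ Neg.neg) (b ∘ Neg.neg) (p.comp (-X)) (q.comp (-X)) where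
  toIsCellMatching := h.toIsCellMatching.comp_neg
  sign_derivative_eq _ _ hxy := by
    simpa [derivative_comp, Left.sign_neg] using h.sign_derivative_eq hxy
  sign_eq_or_isOpen _ _ hxy := by
    simp only [eval_comp, eval_neg, eval_X]
    exact (h.sign_eq_or_isOpen hxy).imp_right fun ho =>
      ⟨ho.1.preimage continuous_neg, ho.2.preimage continuous_neg⟩

-- `p` increases on its cell, so it is positive at the right end `c`. The cell of `c` is not open,
-- so `q` is positive at the matched end `d`, and hence near `d` inside the matched cell.
theorem exists_eval_pos_of_isLUB (h : IsAlmostMatched a b p q) {x c d : ℝ}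
    (ha : IsOpen (a ⁻¹' {a x})) (hc : IsLUB (a ⁻¹' {a x}) c) (hd : IsLUB (b ⁻¹' {a x}) d)
    (hcd : a c = b d) (hder : ∀ t, a t = a x → 0 < p.derivative.eval t) (hx : 0 ≤ p.eval x) :
    ∃ t, b t = a x ∧ 0 < q.eval t := by
  have hcv : a c ≠ a x := notMem_of_mem_upperBounds_of_isOpen ha hc.1
  have hxc : x < c := (hc.1 rfl).lt_of_ne fun hxc => hcv (congrArg a hxc.symm)
  have hincr : sign (p.eval c - p.eval x) = 1 := sign_eval_sub_eval_eq hxc fun t ht => by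
    obtain ⟨r, hr, htr, -⟩ := hc.exists_between ht.2
    exact sign_pos (hder t ((h.ordConnected _).out rfl hr ⟨ht.1.le, htr.le⟩))
  have hpc : 0 < p.eval c := hx.trans_lt (sub_pos.1 (sign_eq_one_iff.1 hincr))
  have hnot : ¬ IsOpen (a ⁻¹' {a c}) := fun hopen => by
    obtain ⟨t, htc, htx⟩ := mem_closure_iff.1 (hc.mem_closure ⟨x, rfl⟩) _ hopen rfl
    exact hcv (htc.symm.trans htx)
  have hqd : 0 < q.eval d := by
    rw [← sign_eq_one_iff, ← (h.sign_eq_or_isOpen hcd).resolve_right fun ho => hnot ho.1]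
    exact sign_pos hpc
  obtain ⟨t, hqt, ht⟩ := mem_closure_iff.1 (hd.mem_closure (h.exists_eq x)) {t | 0 < q.eval t}
    (isOpen_lt continuous_const q.continuous) hqd
  exact ⟨t, ht, hqt⟩

theorem exists_eval_pos_of_derivative_pos (h : IsAlmostMatched a b p q) {x : ℝ}
    (ha : IsOpen (a ⁻¹' {a x})) (hb : IsOpen (b ⁻¹' {a x})) (hder : 0 < p.derivative.eval x)
    (hx : 0 ≤ p.eval x) : ∃ t, b t = a x ∧ 0 < q.eval t := by
  obtain ⟨y, hy⟩ := h.exists_eq x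
  have hq : ∀ s, b s = a x → 0 < q.derivative.eval s := fun s hs =>
    sign_eq_one_iff.1 ((h.sign_derivative_eq hs.symm).symm.trans (sign_pos hder))
  by_cases hbdd : BddAbove (b ⁻¹' {a x})
  · have hp : ∀ t, a t = a x → 0 < p.derivative.eval t := fun t ht =>
      sign_eq_one_iff.1 ((h.sign_derivative_eq (ht.trans hy.symm)).trans (sign_pos (hq y hy)))
    obtain ⟨c, d, hc, hd, hcd⟩ := h.exists_isLUB ha hb ⟨y, hy⟩ hbdd
    exact h.exists_eval_pos_of_isLUB ha hc hd hcd hp hx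
  · have hIci : ∀ t ∈ Set.Ici y, b t = a x := fun t ht => by
      obtain ⟨s, hs, hts⟩ := not_bddAbove_iff.1 hbdd t
      exact (h.symm.ordConnected _).out hy hs ⟨ht, hts.le⟩
    obtain ⟨t, ht, hqt⟩ := exists_eval_pos_of_derivative_pos_Ici fun t ht => hq t (hIci t ht)
    exact ⟨t, hIci t ht, hqt⟩

theorem exists_eval_pos (h : IsAlmostMatched a b p q) {x : ℝ} (ha : IsOpen (a ⁻¹' {a x}))
    (hb : IsOpen (b ⁻¹' {a x})) (hder : p.derivative.eval x ≠ 0) (hx : 0 ≤ p.eval x) :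
    ∃ t, b t = a x ∧ 0 < q.eval t := by
  rcases hder.lt_or_gt with hneg | hpos
  · have hreflect : (a ∘ Neg.neg) (-x) = a x := congrArg a (neg_neg x)
    obtain ⟨t, ht, hqt⟩ := h.comp_neg.exists_eval_pos_of_derivative_pos (x := -x)
      (hreflect ▸ ha.preimage continuous_neg) (hreflect ▸ hb.preimage continuous_neg)
      (by simpa [derivative_comp] using hneg) (by simpa using hx)
    exact ⟨-t, ht.trans hreflect, by simpa using hqt⟩
  · exact h.exists_eval_pos_of_derivative_pos ha hb hpos hx

theorem derivative_eval_ne_zero (h : IsAlmostMatched a b p q) (hp : derivative p ≠ 0) {x : ℝ}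
    (ha : IsOpen (a ⁻¹' {a x})) : p.derivative.eval x ≠ 0 := fun hx => by
  obtain ⟨y, hy⟩ := h.exists_eq x
  refine hp (eq_zero_of_infinite_isRoot _
    ((infinite_of_mem_nhds x (ha.mem_nhds rfl)).mono fun t ht => ?_))
  rw [Set.mem_ofPred_eq, IsRoot.def, ← sign_eq_zero_iff,
    h.sign_derivative_eq (Eq.trans ht hy.symm), ← h.sign_derivative_eq hy.symm, hx, sign_zero]

theorem exists_sign_eval_eq (h : IsAlmostMatched a b p q) (hp : derivative p ≠ 0) (x : ℝ) :
    ∃ y, b y = a x ∧ sign (q.eval y) = sign (p.eval x) := by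
  obtain ⟨y, hy⟩ := h.exists_eq x
  rcases h.sign_eq_or_isOpen hy.symm with hs | ⟨ha, hb⟩
  · exact ⟨y, hy, hs.symm⟩
  have hder : p.derivative.eval x ≠ 0 := h.derivative_eval_ne_zero hp ha
  have hpos : 0 ≤ p.eval x → ∃ t, b t = a x ∧ 0 < q.eval t := h.exists_eval_pos ha hb hder
  have hneg : p.eval x ≤ 0 → ∃ t, b t = a x ∧ q.eval t < 0 := fun hx => by
    simpa using h.neg.exists_eval_pos ha hb (by simpa using hder) (by simpa using hx)
  rcases lt_trichotomy (p.eval x) 0 with hx | hx | hx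
  · obtain ⟨t, ht, hqt⟩ := hneg hx.le
    exact ⟨t, ht, by rw [sign_neg hqt, sign_neg hx]⟩
  · obtain ⟨l, hl, hql⟩ := hneg hx.le
    obtain ⟨r, hr, hqr⟩ := hpos hx.ge
    obtain ⟨t, ht, hqt⟩ := (h.symm.ordConnected (a x)).isPreconnected.intermediate_value hl hr
      q.continuous.continuousOn ⟨hql.le, hqr.le⟩
    exact ⟨t, ht, congrArg sign (hqt.trans hx.symm)⟩
  · obtain ⟨t, ht, hqt⟩ := hpos hx.le
    exact ⟨t, ht, by rw [sign_pos hqt, sign_pos hx]⟩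

end IsAlmostMatched

/-! ### Elimination of one variable -/

section PseudoDivision

variable {A : Type*} [CommRing A]

theorem exists_pseudoDivision (f : A[X]) {g : A[X]} (hg : 0 < g.natDegree) :
    ∃ (k : ℕ) (q r : A[X]), r.natDegree < g.natDegree ∧
      C (g.leadingCoeff ^ k) * f = q * g + r := by
  induction hn : f.natDegree using Nat.strong_induction_on generalizing f with
  | _ n ih =>
  rcases lt_or_ge f.natDegree g.natDegree with hfg | hfg
  · exact ⟨0, 0, f, hfg, by simp⟩
  have hlt : (C g.leadingCoeff * f -
      C f.leadingCoeff * X ^ (f.natDegree - g.natDegree) * g).natDegree < n := by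
    have hcancel := natDegree_cancelLeads_lt_of_natDegree_le_natDegree hfg (hg.trans_le hfg)
    rw [cancelLeads, Nat.sub_eq_zero_of_le hfg, pow_zero, mul_one] at hcancel
    exact hcancel.trans_eq hn
  obtain ⟨k, q, r, hr, hq⟩ := ih _ hlt _ rfl
  refine ⟨k + 1, q + C (g.leadingCoeff ^ k) * (C f.leadingCoeff *
    X ^ (f.natDegree - g.natDegree)), r, hr, ?_⟩
  rw [pow_succ, C_mul]
  linear_combination hq

theorem natDegree_eraseLead_lt {f : A[X]} (hf : 0 < f.natDegree) :
    f.eraseLead.natDegree < f.natDegree :=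
  f.eraseLead_natDegree_le.trans_lt (Nat.sub_lt hf one_pos)

theorem map_eraseLead_of_leadingCoeff_eq_zero {B : Type*} [CommRing B] {f : A[X]} {z : A →+* B}
    (h : z f.leadingCoeff = 0) : f.eraseLead.map z = f.map z := by
  have hsplit := congrArg (Polynomial.map z) f.eraseLead_add_C_mul_X_pow
  rwa [Polynomial.map_add, Polynomial.map_mul, map_C, h, C_0, zero_mul, add_zero] at hsplit

end PseudoDivision

-- `op f g` lowers the degree of `g`, so one pass per degree, from the top, suffices.
theorem exists_finset_closed {B : Type*} (deg : B → ℕ) (op : B → B → Finset B)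
    (hop : ∀ f g, 0 < deg g → ∀ r ∈ op f g, deg r < deg g) (F : Finset B) :
    ∃ F', F ⊆ F' ∧ ∀ f ∈ F', ∀ g ∈ F', 0 < deg g → deg g ≤ deg f → op f g ⊆ F' := by
  classical
  suffices descent : ∀ n, ∀ F : Finset B,
      (∀ f ∈ F, ∀ g ∈ F, n < deg g → deg g ≤ deg f → op f g ⊆ F) →
      ∃ F', F ⊆ F' ∧ ∀ f ∈ F', ∀ g ∈ F', 0 < deg g → deg g ≤ deg f → op f g ⊆ F' from
    descent (F.sup deg) F fun f _ g hg hlt => absurd (Finset.le_sup hg) hlt.not_ge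
  intro n
  induction n with
  | zero => exact fun F hF => ⟨F, subset_rfl, hF⟩
  | succ n ih =>
    intro F hF
    let F₁ := F ∪ {p ∈ F ×ˢ F | deg p.2 = n + 1}.biUnion fun p => op p.1 p.2
    have hmem : ∀ f ∈ F₁, n < deg f → f ∈ F := fun f hf hn => by
      refine (Finset.mem_union.1 hf).resolve_right fun hf => ?_
      obtain ⟨p, hp, hfp⟩ := Finset.mem_biUnion.1 hf
      have hpn : deg p.2 = n + 1 := (Finset.mem_filter.1 hp).2
      have := hop p.1 p.2 (by lia) f hfp
      lia
    obtain ⟨F', hF₁, hF'⟩ := ih F₁ fun f hf g hg hn hle => by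
      have hfF := hmem f hf (hn.trans_le hle)
      have hgF := hmem g hg hn
      rcases (Nat.succ_le_of_lt hn).lt_or_eq with hlt | heq
      · exact (hF f hfF g hgF hlt hle).trans Finset.subset_union_left
      · exact fun r hr => Finset.mem_union_right _ (Finset.mem_biUnion.2
          ⟨(f, g), Finset.mem_filter.2 ⟨Finset.mk_mem_product hfF hgF, heq.symm⟩, hr⟩)
    exact ⟨F', Finset.subset_union_left.trans hF₁, hF'⟩

/-- A family of polynomials closed under derivatives, truncation of the leading term and
pseudo-remainders. The leading coefficients of such a family control its real sign patterns. -/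
structure IsSignClosed {A : Type*} [CommRing A] (F : Finset A[X]) : Prop where
  derivative_mem : ∀ f ∈ F, 0 < f.natDegree → derivative f ∈ F
  eraseLead_mem : ∀ f ∈ F, 0 < f.natDegree → f.eraseLead ∈ F
  exists_pseudoRem : ∀ f ∈ F, ∀ g ∈ F, 0 < g.natDegree → g.natDegree ≤ f.natDegree →
    ∃ (k : ℕ) (q r : A[X]), r ∈ F ∧ r.natDegree < g.natDegree ∧
      C (g.leadingCoeff ^ k) * f = q * g + r

/-- The signs at `x` of the members of `E`, after specializing their coefficients along `z`. -/
noncomputable def signVector {A : Type*} [CommRing A] (E : Finset A[X]) (z : A →+* ℝ) (x : ℝ) :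
    E → SignType :=
  fun f => sign ((f.1.map z).eval x)

section SignVector

variable {A : Type*} [CommRing A] {E F : Finset A[X]} {f g : A[X]} {z w : A →+* ℝ} {x y : ℝ}

theorem exists_superset_isSignClosed (F : Finset A[X]) : ∃ F', F ⊆ F' ∧ IsSignClosed F' := by
  classical
  have hdiv : ∀ f g : A[X], ∃ r : A[X], 0 < g.natDegree → r.natDegree < g.natDegree ∧
      ∃ (k : ℕ) (q : A[X]), C (g.leadingCoeff ^ k) * f = q * g + r := fun f g => by
    by_cases hg : 0 < g.natDegree
    · obtain ⟨k, q, r, hr, hq⟩ := exists_pseudoDivision f hg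
      exact ⟨r, fun _ => ⟨hr, k, q, hq⟩⟩
    · exact ⟨0, fun hg' => absurd hg' hg⟩
  choose rem hrem using hdiv
  obtain ⟨F', hFF', hF'⟩ := exists_finset_closed natDegree
    (fun f g : A[X] => {derivative g, g.eraseLead, rem f g}) (fun f g hg r hr => by
      simp only [Finset.mem_insert, Finset.mem_singleton] at hr
      rcases hr with rfl | rfl | rfl
      · exact natDegree_derivative_lt hg.ne'
      · exact natDegree_eraseLead_lt hg
      · exact (hrem f g hg).1) F
  simp only [Finset.insert_subset_iff, Finset.singleton_subset_iff] at hF'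
  exact ⟨F', hFF', fun f hf hpos => (hF' f hf f hf hpos le_rfl).1,
    fun f hf hpos => (hF' f hf f hf hpos le_rfl).2.1, fun f hf g hg hpos hle =>
      have ⟨hlt, k, q, hq⟩ := hrem f g hpos
      ⟨k, q, rem f g, (hF' f hf g hg hpos hle).2.2, hlt, hq⟩⟩

theorem mem_of_mem_insert_of_natDegree_lt [DecidableEq A[X]] (hg : g ∈ insert f E)
    (hlt : g.natDegree < f.natDegree) : g ∈ E :=
  (Finset.mem_insert.1 hg).resolve_left fun hgf => hlt.ne (congrArg natDegree hgf)

theorem IsSignClosed.of_insert [DecidableEq A[X]] (h : IsSignClosed (insert f E))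
    (hmax : ∀ g ∈ E, g.natDegree ≤ f.natDegree) : IsSignClosed E where
  derivative_mem g hg hpos :=
    mem_of_mem_insert_of_natDegree_lt (h.derivative_mem g (Finset.mem_insert_of_mem hg) hpos)
      ((natDegree_derivative_lt hpos.ne').trans_le (hmax g hg))
  eraseLead_mem g hg hpos :=
    mem_of_mem_insert_of_natDegree_lt (h.eraseLead_mem g (Finset.mem_insert_of_mem hg) hpos)
      ((natDegree_eraseLead_lt hpos).trans_le (hmax g hg))
  exists_pseudoRem g₁ hg₁ g₂ hg₂ hpos hle := by
    obtain ⟨k, q, r, hr, hlt, hq⟩ := h.exists_pseudoRem g₁ (Finset.mem_insert_of_mem hg₁) g₂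
      (Finset.mem_insert_of_mem hg₂) hpos hle
    exact ⟨k, q, r, mem_of_mem_insert_of_natDegree_lt hr (hlt.trans_le (hmax g₂ hg₂)), hlt, hq⟩

theorem IsSignClosed.iterate_derivative_mem_or_eq_zero (h : IsSignClosed E) (hf : f ∈ E) (k : ℕ) :
    derivative^[k] f ∈ E ∨ derivative^[k] f = 0 := by
  induction k with
  | zero => exact Or.inl hf
  | succ k ih =>
    rw [Function.iterate_succ_apply']
    rcases ih with hk | hk
    · rcases Nat.eq_zero_or_pos (derivative^[k] f).natDegree with h0 | hpos
      · exact Or.inr (derivative_of_natDegree_zero h0)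
      · exact Or.inl (h.derivative_mem _ hk hpos)
    · exact Or.inr (by rw [hk, derivative_zero])

theorem signVector_eq_iff : signVector E z x = signVector E w y ↔
    ∀ f ∈ E, sign ((f.map z).eval x) = sign ((f.map w).eval y) := by
  simp only [funext_iff, Subtype.forall, signVector]

theorem IsSignClosed.sign_derivatives_eq (h : IsSignClosed E)
    (hxy : signVector E z x = signVector E w y) (hf : f ∈ E) (k : ℕ) :
    sign ((derivative^[k] (f.map z)).eval x) = sign ((derivative^[k] (f.map w)).eval y) := by
  rw [iterate_derivative_map, iterate_derivative_map]
  rcases h.iterate_derivative_mem_or_eq_zero hf k with hk | hk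
  · exact signVector_eq_iff.1 hxy _ hk
  · simp [hk]

theorem IsSignClosed.lt_of_lt (h : IsSignClosed E) {x₁ x₂ y₁ y₂ : ℝ}
    (h₁ : signVector E z x₁ = signVector E w y₁) (h₂ : signVector E z x₂ = signVector E w y₂)
    (hne : signVector E z x₁ ≠ signVector E z x₂) (hx : x₁ < x₂) : y₁ < y₂ := by
  obtain ⟨f, hf⟩ := Function.ne_iff.1 hne
  exact lt_of_sign_derivatives_eq _ _ (h.sign_derivatives_eq h₁ f.2)
    (h.sign_derivatives_eq h₂ f.2) ⟨0, hf⟩ hx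

theorem IsSignClosed.exists_map_eq_of_map_ne_zero (h : IsSignClosed E) (hg : g ∈ E)
    (hgz : g.map z ≠ 0) : ∃ g' ∈ E, g'.map z = g.map z ∧ z g'.leadingCoeff ≠ 0 := by
  induction hn : g.natDegree using Nat.strong_induction_on generalizing g with
  | _ n ih =>
  by_cases hlc : z g.leadingCoeff = 0
  · have hpos : 0 < g.natDegree := Nat.pos_iff_ne_zero.2 fun h0 => hgz <| by
      rw [leadingCoeff, h0] at hlc
      rw [eq_C_of_natDegree_eq_zero h0, map_C, hlc, C_0]
    have hmap : g.eraseLead.map z = g.map z := map_eraseLead_of_leadingCoeff_eq_zero hlc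
    simpa only [hmap] using ih _ (hn ▸ natDegree_eraseLead_lt hpos)
      (h.eraseLead_mem g hg hpos) (hmap ▸ hgz) rfl
  · exact ⟨g, hg, rfl, hlc⟩

theorem IsSignClosed.sign_eval_eq_of_root [DecidableEq A[X]] (h : IsSignClosed (insert f E))
    (hmax : ∀ g ∈ E, g.natDegree ≤ f.natDegree)
    (hzw : ∀ g ∈ E, sign (z g.leadingCoeff) = sign (w g.leadingCoeff))
    (hxy : signVector E z x = signVector E w y) (hg : g ∈ E) (hgz : g.map z ≠ 0)
    (hgx : (g.map z).eval x = 0) : sign ((f.map z).eval x) = sign ((f.map w).eval y) := by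
  obtain ⟨g', hg', hmap, hlc⟩ := (h.of_insert hmax).exists_map_eq_of_map_ne_zero hg hgz
  rw [← hmap] at hgz hgx
  have hpos : 0 < g'.natDegree :=
    (natDegree_pos_iff_degree_pos.2 (degree_pos_of_root hgz hgx)).trans_le natDegree_map_le
  obtain ⟨k, q, r, hr, hlt, hq⟩ := h.exists_pseudoRem f (Finset.mem_insert_self f E) g'
    (Finset.mem_insert_of_mem hg') hpos (hmax g' hg')
  have hrE : r ∈ E := mem_of_mem_insert_of_natDegree_lt hr (hlt.trans_le (hmax g' hg'))
  have hgy : (g'.map w).eval y = 0 := by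
    rw [← sign_eq_zero_iff, ← signVector_eq_iff.1 hxy g' hg', hgx, sign_zero]
  have heval : ∀ (v : A →+* ℝ) (t : ℝ), (g'.map v).eval t = 0 →
      v g'.leadingCoeff ^ k * (f.map v).eval t = (r.map v).eval t := fun v t ht => by
    simpa [ht] using congrArg (fun p => (p.map v).eval t) hq
  have hmul := signVector_eq_iff.1 hxy r hrE
  rw [← heval z x hgx, ← heval w y hgy, sign_mul, sign_mul, sign_pow, sign_pow, hzw g' hg'] at hmul
  refine mul_left_cancel₀ (pow_ne_zero k ?_) hmul
  rwa [← hzw g' hg', sign_ne_zero]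

theorem isOpen_signVector_preimage (hE : ∀ g ∈ E, g.map z = 0 ∨ (g.map z).eval x ≠ 0) :
    IsOpen (signVector E z ⁻¹' {signVector E z x}) := by
  have hpre : signVector E z ⁻¹' {signVector E z x} =
      ⋂ g ∈ E, {t | sign ((g.map z).eval t) = sign ((g.map z).eval x)} := by
    ext t
    simp [signVector_eq_iff]
  rw [hpre]
  refine isOpen_biInter_finset fun g hg => ?_
  rcases hE g hg with h0 | hne
  · simp [h0]
  · rcases hne.lt_or_gt with hneg | hpos
    · simpa only [sign_neg hneg, sign_eq_neg_one_iff] using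
        isOpen_lt (g.map z).continuous continuous_const
    · simpa only [sign_pos hpos, sign_eq_one_iff] using
        isOpen_lt continuous_const (g.map z).continuous

theorem map_eq_zero_of_isCellMatching (hm : IsCellMatching (signVector E z) (signVector E w))
    (hg : g ∈ E) (hgz : g.map z = 0) : g.map w = 0 := by
  refine Polynomial.funext fun s => ?_
  obtain ⟨t, ht⟩ := hm.symm.exists_eq s
  rw [eval_zero, ← sign_eq_zero_iff, ← signVector_eq_iff.1 ht g hg, hgz, eval_zero, sign_zero]

theorem IsSignClosed.isAlmostMatched [DecidableEq A[X]] (h : IsSignClosed (insert f E))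
    (hpos : 0 < f.natDegree) (hmax : ∀ g ∈ E, g.natDegree ≤ f.natDegree)
    (hzw : ∀ g ∈ E, sign (z g.leadingCoeff) = sign (w g.leadingCoeff))
    (hm : IsCellMatching (signVector E z) (signVector E w)) :
    IsAlmostMatched (signVector E z) (signVector E w) (f.map z) (f.map w) where
  toIsCellMatching := hm
  sign_derivative_eq x y hxy := by
    rw [derivative_map, derivative_map]
    exact signVector_eq_iff.1 hxy _ (mem_of_mem_insert_of_natDegree_lt
      (h.derivative_mem f (Finset.mem_insert_self f E) hpos) (natDegree_derivative_lt hpos.ne'))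
  sign_eq_or_isOpen x y hxy := by
    by_cases hroot : ∃ g ∈ E, g.map z ≠ 0 ∧ (g.map z).eval x = 0
    · obtain ⟨g, hg, hgz, hgx⟩ := hroot
      exact Or.inl (h.sign_eval_eq_of_root hmax hzw hxy hg hgz hgx)
    · have hz : ∀ g ∈ E, g.map z = 0 ∨ (g.map z).eval x ≠ 0 := fun g hg =>
        or_iff_not_imp_left.2 fun hgz hgx => hroot ⟨g, hg, hgz, hgx⟩
      have hw : ∀ g ∈ E, g.map w = 0 ∨ (g.map w).eval y ≠ 0 := fun g hg =>
        (hz g hg).imp (map_eq_zero_of_isCellMatching hm hg) fun hgx => by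
          rwa [← sign_ne_zero, ← signVector_eq_iff.1 hxy g hg, sign_ne_zero]
      exact Or.inr ⟨isOpen_signVector_preimage hz, hxy ▸ isOpen_signVector_preimage hw⟩

theorem IsSignClosed.exists_signVector_insert_eq [DecidableEq A[X]]
    (h : IsSignClosed (insert f E)) (hmax : ∀ g ∈ E, g.natDegree ≤ f.natDegree)
    (hzw : ∀ g ∈ insert f E, sign (z g.leadingCoeff) = sign (w g.leadingCoeff))
    (hm : IsCellMatching (signVector E z) (signVector E w)) (x : ℝ) :
    ∃ y, signVector (insert f E) w y = signVector (insert f E) z x := by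
  have hf : f ∈ insert f E := Finset.mem_insert_self f E
  suffices ∃ y, signVector E w y = signVector E z x ∧
      sign ((f.map w).eval y) = sign ((f.map z).eval x) by
    simpa only [signVector_eq_iff, Finset.forall_mem_insert, and_comm] using this
  obtain ⟨y, hy⟩ := hm.exists_eq x
  rcases Nat.eq_zero_or_pos f.natDegree with h0 | hpos
  · have hlc := hzw f hf
    rw [leadingCoeff, h0] at hlc
    rw [eq_C_of_natDegree_eq_zero h0]
    exact ⟨y, hy, by simpa using hlc.symm⟩
  by_cases hz : z f.leadingCoeff = 0
  · have hw : w f.leadingCoeff = 0 := by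
      rw [← sign_eq_zero_iff, ← hzw f hf, hz, sign_zero]
    rw [← map_eraseLead_of_leadingCoeff_eq_zero hz, ← map_eraseLead_of_leadingCoeff_eq_zero hw]
    exact ⟨y, hy, signVector_eq_iff.1 hy _ (mem_of_mem_insert_of_natDegree_lt
      (h.eraseLead_mem f hf hpos) (natDegree_eraseLead_lt hpos))⟩
  · have hder : derivative (f.map z) ≠ 0 := fun hder => hpos.ne' <| by
      rw [← natDegree_map_of_leadingCoeff_ne_zero z hz]
      exact derivative_eq_zero.1 hder
    exact (h.isAlmostMatched hpos hmax (fun g hg => hzw g (Finset.mem_insert_of_mem hg))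
      hm).exists_sign_eval_eq hder x

theorem IsSignClosed.isCellMatching (h : IsSignClosed F)
    (hzw : ∀ f ∈ F, sign (z f.leadingCoeff) = sign (w f.leadingCoeff)) :
    IsCellMatching (signVector F z) (signVector F w) := by
  classical
  refine ⟨?_, fun _ _ _ _ => h.lt_of_lt⟩
  induction F using Finset.induction_on_max_value (ι := A[X]) natDegree with
  | empty => rw [Subsingleton.elim (signVector ∅ z) (signVector ∅ w)]
  | insert f E _ hmax ih =>
    have hE : IsSignClosed E := h.of_insert hmax
    have hm : IsCellMatching (signVector E z) (signVector E w) :=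
      ⟨ih hE fun g hg => hzw g (Finset.mem_insert_of_mem hg), fun _ _ _ _ => hE.lt_of_lt⟩
    refine subset_antisymm (Set.range_subset_iff.2 fun x => ?_)
      (Set.range_subset_iff.2 fun y => ?_)
    · exact h.exists_signVector_insert_eq hmax hzw hm x
    · exact h.exists_signVector_insert_eq hmax (fun g hg => (hzw g hg).symm) hm.symm y

theorem exists_finset_forall_exists_sign_eval_eq (F : Finset A[X]) :
    ∃ H : Finset A, ∀ z w : A →+* ℝ, (∀ c ∈ H, sign (z c) = sign (w c)) →
      ∀ x, ∃ y, ∀ f ∈ F, sign ((f.map z).eval x) = sign ((f.map w).eval y) := by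
  classical
  obtain ⟨F', hFF', hF'⟩ := exists_superset_isSignClosed F
  refine ⟨F'.image leadingCoeff, fun z w hzw x => ?_⟩
  obtain ⟨y, hy⟩ := (hF'.isCellMatching (Finset.forall_mem_image.1 hzw)).exists_eq x
  exact ⟨y, fun f hf => signVector_eq_iff.1 hy.symm f (hFF' hf)⟩

end SignVector

end Feynman

namespace Feynman

open MvPolynomial
open SignType (sign)

/-! ### The Tarski–Seidenberg projection theorem -/

/-- Membership in `B` only depends on the signs of finitely many polynomials. This is equivalent to
`B` being semialgebraic, and it is the form in which a variable can be eliminated. -/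
def IsSignDetermined {σ : Type*} (B : Set (σ → ℝ)) : Prop :=
  ∃ P : Finset (MvPolynomial σ ℝ), ∀ a b : σ → ℝ,
    (∀ p ∈ P, sign (eval a p) = sign (eval b p)) → a ∈ B → b ∈ B

section TarskiSeidenberg

variable {σ τ : Type*}

theorem IsSemialgebraic.union {A B : Set (σ → ℝ)} (hA : IsSemialgebraic A)
    (hB : IsSemialgebraic B) : IsSemialgebraic (A ∪ B) := by
  rw [← compl_compl (A ∪ B), Set.compl_union]
  exact .compl _ (.inter _ _ hA.compl hB.compl)

theorem IsSemialgebraic.empty : IsSemialgebraic (∅ : Set (σ → ℝ)) := by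
  simpa using (IsSemialgebraic.nonneg (0 : MvPolynomial σ ℝ)).compl

/-- The Boolean algebra of semialgebraic subsets of `ℝ^σ`, which provides their finite unions and
intersections. -/
def semialgebraicSets (σ : Type*) : BooleanSubalgebra (Set (σ → ℝ)) where
  carrier := {B | IsSemialgebraic B}
  supClosed' _ hA _ hB := hA.union hB
  infClosed' _ hA _ hB := hA.inter _ _ hB
  compl_mem' hA := hA.compl
  bot_mem' := .empty

theorem isSemialgebraic_sign_eq (p : MvPolynomial σ ℝ) (s : SignType) :
    IsSemialgebraic {z | sign (eval z p) = s} := by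
  have hle : IsSemialgebraic {z | eval z p ≤ 0} := by
    simpa using IsSemialgebraic.nonneg (-p)
  have hge : IsSemialgebraic {z | 0 ≤ eval z p} := .nonneg p
  rcases s.trichotomy with rfl | rfl | rfl
  · simpa [sign_eq_neg_one_iff, Set.compl_ofPred] using hge.compl
  · convert hle.inter _ _ hge using 1
    exact Set.ext fun z => sign_eq_zero_iff.trans le_antisymm_iff
  · simpa [sign_eq_one_iff, Set.compl_ofPred] using hle.compl

theorem IsSignDetermined.isSemialgebraic {B : Set (σ → ℝ)} (h : IsSignDetermined B) :
    IsSemialgebraic B := by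
  obtain ⟨P, hP⟩ := h
  let signs (z : σ → ℝ) : P → SignType := fun p => sign (eval z p.1)
  have hB : B = ⨆ s ∈ signs '' B, ⨅ p : P, {z | sign (eval z p.1) = s p} := by
    ext b
    simp only [Set.iSup_eq_iUnion, Set.iInf_eq_iInter, Set.biUnion_image, Set.mem_iUnion,
      Set.mem_iInter, Set.mem_ofPred_eq]
    exact ⟨fun hb => ⟨b, hb, fun _ => rfl⟩,
      fun ⟨a, ha, hab⟩ => hP a b (fun p hp => (hab ⟨p, hp⟩).symm) ha⟩
  rw [hB]
  exact (semialgebraicSets σ).biSup_mem (Set.toFinite _) fun s _ =>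
    (semialgebraicSets σ).iInf_mem fun p => isSemialgebraic_sign_eq p.1 (s p)

theorem IsSemialgebraic.isSignDetermined {B : Set (σ → ℝ)} (h : IsSemialgebraic B) :
    IsSignDetermined B := by
  classical
  induction h with
  | nonneg p =>
    refine ⟨{p}, fun a b hab ha => ?_⟩
    rwa [Set.mem_ofPred_eq, ← sign_nonneg_iff, ← hab p (Finset.mem_singleton_self p),
      sign_nonneg_iff]
  | compl A _ ih =>
    obtain ⟨P, hP⟩ := ih
    exact ⟨P, fun a b hab ha hb => ha (hP b a (fun p hp => (hab p hp).symm) hb)⟩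
  | inter A B _ _ ihA ihB =>
    obtain ⟨P, hP⟩ := ihA
    obtain ⟨Q, hQ⟩ := ihB
    exact ⟨P ∪ Q, fun a b hab ha =>
      ⟨hP a b (fun p hp => hab p (Finset.mem_union_left Q hp)) ha.1,
        hQ a b (fun q hq => hab q (Finset.mem_union_right P hq)) ha.2⟩⟩

theorem IsSemialgebraic.preimage_comp (k : σ → τ) {B : Set (σ → ℝ)} (h : IsSemialgebraic B) :
    IsSemialgebraic {z : τ → ℝ | z ∘ k ∈ B} := by
  induction h with
  | nonneg p =>
    simpa only [eval_rename, Set.mem_ofPred_eq] using IsSemialgebraic.nonneg (rename k p)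
  | compl A _ ih => exact ih.compl
  | inter A B _ _ ihA ihB => exact ihA.inter _ _ ihB

theorem IsSemialgebraic.exists_option_elim {B : Set (Option σ → ℝ)} (h : IsSemialgebraic B) :
    IsSemialgebraic {z : σ → ℝ | ∃ t : ℝ, (fun i : Option σ => i.elim t z) ∈ B} := by
  classical
  obtain ⟨P, hP⟩ := h.isSignDetermined
  obtain ⟨H, hH⟩ := exists_finset_forall_exists_sign_eval_eq (P.image (optionEquivLeft ℝ σ))
  refine IsSignDetermined.isSemialgebraic ⟨H, fun z w hzw ⟨t, ht⟩ => ?_⟩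
  obtain ⟨s, hs⟩ := hH (eval z) (eval w) hzw t
  refine ⟨s, hP _ _ (fun p hp => ?_) ht⟩
  rw [optionEquivLeft_elim_eval, optionEquivLeft_elim_eval]
  exact hs _ (Finset.mem_image_of_mem _ hp)

theorem IsSemialgebraic.exists_sumElim [Finite τ] {B : Set (σ ⊕ τ → ℝ)}
    (h : IsSemialgebraic B) :
    IsSemialgebraic {z : σ → ℝ | ∃ u : τ → ℝ, Sum.elim z u ∈ B} := by
  revert B
  refine Finite.induction_empty_option
    (P := fun τ => ∀ {B : Set (σ ⊕ τ → ℝ)}, IsSemialgebraic B →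
      IsSemialgebraic {z : σ → ℝ | ∃ u : τ → ℝ, Sum.elim z u ∈ B})
    (fun {τ τ'} e ih B h => ?_) (fun {B} h => ?_) (fun {τ} _ ih B h => ?_) τ
  · convert ih (h.preimage_comp (Sum.map id e.symm)) using 1
    ext z
    simp only [Set.mem_ofPred_eq, Sum.elim_comp_map, Function.comp_id]
    exact (e.arrowCongr (Equiv.refl ℝ)).surjective.exists
  · convert h.preimage_comp (Sum.elim id PEmpty.elim) using 1
    ext z
    simp only [Set.mem_ofPred_eq, Sum.comp_elim, Function.comp_id]
    rw [Unique.exists_iff]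
    exact iff_of_eq (congrArg (· ∈ B) (congrArg _ (Subsingleton.elim _ _)))
  · convert ih (h.preimage_comp
      (Sum.elim (some ∘ Sum.inl) (Option.map Sum.inr))).exists_option_elim using 1
    ext z
    have helim : ∀ (t : ℝ) (u : τ → ℝ), (fun i : Option (σ ⊕ τ) => i.elim t (Sum.elim z u)) ∘
        Sum.elim (some ∘ Sum.inl) (Option.map Sum.inr) = Sum.elim z fun i => i.elim t u :=
      fun t u => funext <| by rintro (_ | _ | _) <;> rfl
    simp only [Set.mem_ofPred_eq, helim]
    constructor
    · rintro ⟨u, hu⟩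
      refine ⟨u ∘ some, u none, ?_⟩
      convert hu using 2
      exact funext fun i => i.rec rfl fun _ => rfl
    · rintro ⟨u, t, hut⟩
      exact ⟨_, hut⟩

end TarskiSeidenberg

/-! ### Copositivity in linear families of polynomials -/

section LinearFamily

variable {E σ τ : Type*} [AddCommGroup E] [Module ℝ E] (L : E →ₗ[ℝ] MvPolynomial τ ℝ)

theorem setOf_isCopositive_eq_iInter : {z | IsCopositive (L z)} =
    ⋂ u ∈ {u : τ → ℝ | ∀ e, 0 ≤ u e}, {z | 0 ≤ ((aeval u).toLinearMap ∘ₗ L) z} := by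
  ext z
  simp only [Set.mem_iInter]
  rfl

theorem convex_setOf_isCopositive : Convex ℝ {z | IsCopositive (L z)} := by
  rw [setOf_isCopositive_eq_iInter]
  exact convex_iInter₂ fun u _ => convex_halfSpace_ge (LinearMap.isLinear _) 0

theorem isClosed_setOf_isCopositive [TopologicalSpace E] [IsTopologicalAddGroup E]
    [ContinuousSMul ℝ E] [T2Space E] [FiniteDimensional ℝ E] :
    IsClosed {z | IsCopositive (L z)} := by
  rw [setOf_isCopositive_eq_iInter]
  exact isClosed_biInter fun u _ =>
    isClosed_le continuous_const (LinearMap.continuous_of_finiteDimensional _)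

theorem zero_mem_setOf_isCopositive : 0 ∈ {z | IsCopositive (L z)} := fun u _ => by
  rw [map_zero, map_zero]

theorem smul_mem_setOf_isCopositive {c : ℝ} (hc : 0 ≤ c) {z : E}
    (hz : z ∈ {z | IsCopositive (L z)}) : c • z ∈ {z | IsCopositive (L z)} := fun u hu => by
  rw [map_smul, smul_eval]
  exact mul_nonneg hc (hz u hu)

theorem exists_eval_sumElim_eq_eval [Finite σ] (L : (σ → ℝ) →ₗ[ℝ] MvPolynomial τ ℝ) :
    ∃ Φ : MvPolynomial (σ ⊕ τ) ℝ, ∀ z u, eval (Sum.elim z u) Φ = eval u (L z) := by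
  classical
  have := Fintype.ofFinite σ
  refine ⟨∑ k, X (Sum.inl k) * rename Sum.inr (L (Pi.single k 1)), fun z u => ?_⟩
  conv_rhs => rw [← LinearMap.sum_single_apply (fun _ => ℝ) z, map_sum]
  simp only [map_sum, map_mul, eval_X, eval_rename, Sum.elim_comp_inr, Sum.elim_inl]
  refine Finset.sum_congr rfl fun k _ => ?_
  rw [← smul_eval, ← map_smul, ← Pi.single_smul, smul_eq_mul, mul_one]

theorem isSemialgebraic_setOf_isCopositive [Finite σ] [Finite τ]
    (L : (σ → ℝ) →ₗ[ℝ] MvPolynomial τ ℝ) : IsSemialgebraic {z | IsCopositive (L z)} := by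
  obtain ⟨Φ, hΦ⟩ := exists_eval_sumElim_eq_eval L
  have horthant : IsSemialgebraic (⨅ e : τ, {v : σ ⊕ τ → ℝ | 0 ≤ eval v (X (Sum.inr e))}) :=
    (semialgebraicSets _).iInf_mem fun e => .nonneg (X (Sum.inr e))
  have hviolation := (horthant.inter _ _ (IsSemialgebraic.nonneg Φ).compl).exists_sumElim
  convert hviolation.compl using 1
  ext z
  simp [IsCopositive, hΦ]

end LinearFamily

/-! ### The second Symanzik polynomial as a function of the kinematics -/

section Symanzik

variable {α β : Type*} {G : Graph α β}

theorem isLinearMap_offDiagGram (i j : External G) :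
    IsLinearMap ℝ fun z : KinSpace G => offDiagGram z i j := by
  unfold offDiagGram
  split_ifs
  · exact (0 : KinSpace G →ₗ[ℝ] ℝ).isLinear
  · exact (LinearMap.proj _).isLinear

theorem offDiagGram_nonneg {z : KinSpace G} (hz : ∀ i, 0 ≤ z i) (i j : External G) :
    0 ≤ offDiagGram z i j := by
  unfold offDiagGram
  split_ifs
  · exact le_rfl
  · exact hz _

theorem IsAttached.unique {S : Finset β} {i : External G} {T₁ T₂ : Component G S}
    (h₁ : IsAttached i T₁) (h₂ : IsAttached i T₂) : T₁ = T₂ := by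
  obtain ⟨v₁, rfl, hv₁⟩ := h₁
  obtain ⟨v₂, rfl, hv₂⟩ := h₂
  by_cases hv : v₁ = v₂
  · rw [hv]
  · obtain ⟨y, hy⟩ := hv₁
    have hv₂y : v₂.1 = y := hv₂.eq_of_isLink_of_ne_left hy fun h => hv (Subtype.ext h.symm)
    refine SimpleGraph.ConnectedComponent.connectedComponentMk_eq_of_adj ?_
    rw [Graph.toSimpleGraph_adj]
    exact ⟨hv, i.1, hv₂y ▸ hy⟩

theorem IsSpanningTwoForest.finite_component {S : Finset β} (hS : IsSpanningTwoForest G S) :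
    Finite (Component G S) :=
  Nat.finite_of_card_ne_zero (hS.2.2.2.trans_ne two_ne_zero)

theorem finrank_kinSpace [Finite β] (G : Graph α β) : Module.finrank ℝ (KinSpace G) =
    (Nat.card (External G)).choose 2 + Nat.card (Internal G) := by
  classical
  have := Fintype.ofFinite (KinIndex G)
  rw [Module.finrank_fintype_fun_eq_card, ← Nat.card_eq_fintype_card, Nat.card_sum,
    Sym2.natCard_subtype_not_diag]

variable [Fintype β]

theorem isLinearMap_gram (i j : External G) :
    IsLinearMap ℝ fun z : KinSpace G => gram z i j := by
  unfold gram
  split_ifs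
  · exact ⟨fun z w => by
      simp only [(isLinearMap_offDiagGram _ _).map_add, Finset.sum_add_distrib, neg_add],
      fun c z => by
      simp only [(isLinearMap_offDiagGram _ _).map_smul, ← Finset.smul_sum, smul_neg]⟩
  · exact isLinearMap_offDiagGram i j

theorem isLinearMap_crossSum {S : Finset β} (T₁ T₂ : Component G S) :
    IsLinearMap ℝ fun z : KinSpace G => crossSum z T₁ T₂ where
  map_add z w := by
    simp only [crossSum, (isLinearMap_gram _ _).map_add, Finset.sum_add_distrib]
  map_smul c z := by
    simp only [crossSum, (isLinearMap_gram _ _).map_smul, Finset.smul_sum]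

theorem isLinearMap_forestCoeff (S : Finset β) [Finite (Component G S)] :
    IsLinearMap ℝ fun z : KinSpace G => forestCoeff z S where
  map_add z w := by
    rw [forestCoeff, forestCoeff, forestCoeff,
      ← finsum_add_distrib (Set.toFinite _) (Set.toFinite _)]
    refine finsum_congr fun ⟨q, _⟩ => ?_
    induction q with
    | h T₁ T₂ => exact (isLinearMap_crossSum T₁ T₂).map_add z w
  map_smul c z := by
    rw [forestCoeff, forestCoeff, smul_finsum]
    refine finsum_congr fun ⟨q, _⟩ => ?_
    induction q with
    | h T₁ T₂ => exact (isLinearMap_crossSum T₁ T₂).map_smul c z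

theorem isLinearMap_secondSymanzik (G : Graph α β) : IsLinearMap ℝ (secondSymanzik G) := by
  classical
  have hcoeff (S : Finset β) (hS : S ∈ Finset.univ.filter (IsSpanningTwoForest G)) :
      IsLinearMap ℝ fun z : KinSpace G => forestCoeff z S :=
    have := (Finset.mem_filter.1 hS).2.finite_component
    isLinearMap_forestCoeff S
  constructor
  · intro z w
    simp only [secondSymanzik, mass, Pi.add_apply, map_add, add_mul, Finset.sum_add_distrib]
    rw [Finset.sum_congr rfl fun S hS => by rw [(hcoeff S hS).map_add, map_add, add_mul],
      Finset.sum_add_distrib, add_add_add_comm]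
  · intro c z
    simp only [secondSymanzik, mass, Pi.smul_apply, smul_eq_mul, map_mul, mul_assoc,
      ← Finset.mul_sum, smul_eq_C_mul, mul_add]
    rw [Finset.sum_congr rfl fun S hS => by
      rw [(hcoeff S hS).map_smul, smul_eq_mul, map_mul, mul_assoc], Finset.mul_sum]

theorem crossSum_nonneg {z : KinSpace G} (hz : ∀ i, 0 ≤ z i) {S : Finset β}
    {T₁ T₂ : Component G S} (hne : T₁ ≠ T₂) : 0 ≤ crossSum z T₁ T₂ := by
  classical
  refine Finset.sum_nonneg fun i hi => Finset.sum_nonneg fun j hj => ?_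
  have hij : i ≠ j := by
    rintro rfl
    exact hne ((Finset.mem_filter.1 hi).2.unique (Finset.mem_filter.1 hj).2)
  rw [gram, if_neg hij]
  exact offDiagGram_nonneg hz i j

theorem forestCoeff_nonneg {z : KinSpace G} (hz : ∀ i, 0 ≤ z i) (S : Finset β) :
    0 ≤ forestCoeff z S := by
  refine finsum_nonneg fun ⟨q, hq⟩ => ?_
  induction q with
  | h T₁ T₂ => exact crossSum_nonneg hz fun h => hq (Sym2.mk_isDiag_iff.2 h)

theorem isCopositive_complMonomial (G : Graph α β) (S : Finset β) :
    IsCopositive (complMonomial G S) := fun u hu => by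
  rw [complMonomial, map_prod]
  exact Finset.prod_nonneg fun e _ => (eval_X (f := u) e).symm ▸ hu e

theorem isCopositive_firstSymanzik (G : Graph α β) : IsCopositive (firstSymanzik G) :=
  fun u hu => by
    rw [firstSymanzik, map_sum]
    exact Finset.sum_nonneg fun T _ => isCopositive_complMonomial G T u hu

theorem isCopositive_secondSymanzik {z : KinSpace G} (hz : ∀ i, 0 ≤ z i) :
    IsCopositive (secondSymanzik G z) := by
  classical
  intro u hu
  simp only [secondSymanzik, map_add, map_mul, map_sum, eval_C, eval_X]
  have hforests : 0 ≤ ∑ S : Finset β with IsSpanningTwoForest G S,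
      forestCoeff z S * eval u (complMonomial G S) :=
    Finset.sum_nonneg fun S _ =>
      mul_nonneg (forestCoeff_nonneg hz S) (isCopositive_complMonomial G S u hu)
  have hmasses : 0 ≤ ∑ e : Internal G, mass z e * u e :=
    Finset.sum_nonneg fun e _ => mul_nonneg (hz _) (hu e)
  exact add_nonneg hforests (mul_nonneg hmasses (isCopositive_firstSymanzik G u hu))

theorem setOf_forall_pos_subset_copositiveCone (G : Graph α β) :
    {z : KinSpace G | ∀ i, 0 < z i} ⊆ copositiveCone G :=
  fun _ hz => isCopositive_secondSymanzik fun i => (hz i).le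

theorem interior_copositiveCone_nonempty (G : Graph α β) :
    (interior (copositiveCone G)).Nonempty := by
  have hopen : IsOpen {z : KinSpace G | ∀ i, 0 < z i} := by
    simp only [Set.ofPred_forall]
    exact isOpen_iInter_of_finite fun i => isOpen_lt continuous_const (continuous_apply i)
  exact ⟨1, interior_maximal (setOf_forall_pos_subset_copositiveCone G) hopen fun _ => one_pos⟩

end Symanzik

end Feynman

theorem mainTheorem7_general {α β : Type*} [Fintype β] (G : Graph α β) :
    Module.finrank ℝ (Feynman.KinSpace G) =
        (Nat.card (Feynman.External G)).choose 2 + Nat.card (Feynman.Internal G) ∧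
    (∃ L : (Feynman.Internal G → ℝ) → (Feynman.KinSpace G →ₗ[ℝ] ℝ),
      (∀ u z, L u z = MvPolynomial.eval u (Feynman.secondSymanzik G z)) ∧
      Feynman.copositiveCone G = ⋂ u ∈ {u : Feynman.Internal G → ℝ | ∀ e, 0 ≤ u e},
        {z | 0 ≤ L u z}) ∧
    IsClosed (Feynman.copositiveCone G) ∧
    Convex ℝ (Feynman.copositiveCone G) ∧
    (0 : Feynman.KinSpace G) ∈ Feynman.copositiveCone G ∧
    (∀ c : ℝ, 0 ≤ c → ∀ z ∈ Feynman.copositiveCone G, c • z ∈ Feynman.copositiveCone G) ∧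
    {z : Feynman.KinSpace G | ∀ i, 0 < z i} ⊆ Feynman.copositiveCone G ∧
    (interior (Feynman.copositiveCone G)).Nonempty ∧
    Feynman.IsSemialgebraic (Feynman.copositiveCone G) := by
  let F := (Feynman.isLinearMap_secondSymanzik G).mk'
  exact ⟨Feynman.finrank_kinSpace G,
    ⟨fun u => (MvPolynomial.aeval u).toLinearMap ∘ₗ F, fun _ _ => rfl,
      Feynman.setOf_isCopositive_eq_iInter F⟩,
    Feynman.isClosed_setOf_isCopositive F, Feynman.convex_setOf_isCopositive F,
    Feynman.zero_mem_setOf_isCopositive F,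
    fun _ hc _ hz => Feynman.smul_mem_setOf_isCopositive F hc hz,
    Feynman.setOf_forall_pos_subset_copositiveCone G, Feynman.interior_copositiveCone_nonempty G,
    Feynman.isSemialgebraic_setOf_isCopositive F⟩

theorem mainTheorem7 {α β : Type*} [Fintype α] [Fintype β] (G : Graph α β)
    (hG : Feynman.IsConnected G) :
    -- the ambient space has dimension `binom(N, 2) + n`
    Module.finrank ℝ (Feynman.KinSpace G) =
        (Nat.card (Feynman.External G)).choose 2 + Nat.card (Feynman.Internal G) ∧
    -- the cone is cut out by the linear inequalities `ℱ_z(u) ≥ 0`, one for each `u ≥ 0`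
    (∃ L : (Feynman.Internal G → ℝ) → (Feynman.KinSpace G →ₗ[ℝ] ℝ),
      (∀ u z, L u z = MvPolynomial.eval u (Feynman.secondSymanzik G z)) ∧
      Feynman.copositiveCone G = ⋂ u ∈ {u : Feynman.Internal G → ℝ | ∀ e, 0 ≤ u e},
        {z | 0 ≤ L u z}) ∧
    -- it is a closed convex cone
    IsClosed (Feynman.copositiveCone G) ∧
    Convex ℝ (Feynman.copositiveCone G) ∧
    (0 : Feynman.KinSpace G) ∈ Feynman.copositiveCone G ∧
    (∀ c : ℝ, 0 ≤ c → ∀ z ∈ Feynman.copositiveCone G, c • z ∈ Feynman.copositiveCone G) ∧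
    -- it contains the positive orthant, and it is full-dimensional
    {z : Feynman.KinSpace G | ∀ i, 0 < z i} ⊆ Feynman.copositiveCone G ∧
    (interior (Feynman.copositiveCone G)).Nonempty ∧
    -- it is semialgebraic
    Feynman.IsSemialgebraic (Feynman.copositiveCone G) := by
  exact mainTheorem7_general G
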